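/- Let $n\ge 2$, let $\mathbb{H}^n=\{x\in\mathbb{R}^n : x_1>0\}$ with the metric $g_{\mathbb{H}^n}=x_1^{-2}(dx_1^2+\cdots+dx_n^2)$, and let $\mathbb{H}^n\times_{-1}\mathbb{R}$ be $\mathbb{H}^n\times\mathbb{R}$ with the Lorentzian metric $g_{\mathbb{H}^n}-dt^2$. Put $\rho(x)=-\ln x_1$ (the sign for which $\operatorname{div}(\nabla\rho)=n-1$). Let $\Omega\subseteq\mathbb{H}^n$ be open, connected and non-empty, and let $u\in C^2(\Omega)$. The graph $\Gamma(p)=(p,u(p))$, $p\in\Omega$, is called space-like if its induced metric is positive definite, a translator if its mean curvature vector $\mathbf{H}$ (the trace of the second fundamental form) satisfies $\mathbf{H}=\partial_t^{\perp}$, and foliated by horospheres if through each of its points there passes a horosphere $\{x_1=c\}\times\{t\}$, with $c>0$ and $t\in\mathbb{R}$, that is contained in the graph. Define $$P(x)=-\tfrac14\ln|1-x|+\tfrac12\cdot\tfrac1{1-x}+\tfrac14\ln|1+x|,$$ $$Q(x)=\tfrac{1}{2m-2}\ln|1-x|+\tfrac1{2m+2}\ln|1+x|-\tfrac{m}{m^2-1}\ln|1-mx|,\qquad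 m=n-1>1,$$ which are antiderivatives of $\frac{1}{(1-x^2)(1-x)}$ and $\frac1{(1-x^2)(1-mx)}$, and let $P_2=P|_{(-1,1)}$, $Q_2=Q|_{(-1,1/m)}$, $Q_3=Q|_{(1/m,1)}$, which are bijections onto $\mathbb{R}$. Suppose that $\Gamma$ is a space-like translator. Then $\Gamma$ is foliated by horospheres if and only if there are an open interval $I\subseteq\mathbb{R}$ with $\Omega=\rho^{-1}(I)$ and a $C^2$ function $f:\mathbb{R}\to\mathbb{R}$ such that $u=f\circ\rho$ on $\Omega$ and $f$ is one of the following, where $s_0,f_0\in\mathbb{R}$ are constants: 1. $n>2$ and $f(s)=\frac{s}{n-1}+f_0$; 2. $n=2$ and $f(s)=\int_{s_0}^{s}P_2^{-1}(r-s_0)\,dr+f_0$; 3. $n>2$ and $f(s)=\int_{s_0}^{s}Q_2^{-1}(r-s_0)\,dr+f_0$; 4. $n>2$ and $f(s)=\int_{s_0}^{s}Q_3^{-1}(r-s_0)\,dr+f_0$. Conversely, for each $u$ of this form on $\Omega=\rho^{-1}(I)$, the graph $\Gamma$ is a space-like translator. -/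

import Mathlib

open Set

noncomputable section

namespace HESU

/-! ### Submanifolds of a pseudo-Riemannian metric given in a global chart -/

section PseudoRiemannian

variable {ι κ : Type*} [Fintype ι] [DecidableEq ι] [Fintype κ] [DecidableEq κ]

/-- The partial derivative `∂ᵢ f` at `x`. -/
def pd (i : ι) (f : (ι → ℝ) → ℝ) (x : ι → ℝ) : ℝ :=
  fderiv ℝ f x (Pi.single i 1)

/-- The Christoffel symbol `Γᶜₐᵦ` of the Levi-Civita connection of the metric `g`, at `y`. -/
def christoffel (g : (κ → ℝ) → Matrix κ κ ℝ) (y : κ → ℝ) (c a b : κ) : ℝ :=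
  (1 / 2) * ∑ d, (g y)⁻¹ c d *
    (pd a (fun z => g z b d) y + pd b (fun z => g z a d) y - pd d (fun z => g z a b) y)

/-- The scalar product `g_y(V, W)` of two tangent vectors at `y`. -/
def scal (g : (κ → ℝ) → Matrix κ κ ℝ) (y V W : κ → ℝ) : ℝ :=
  ∑ a, ∑ b, g y a b * V a * W b

/-- The tangent vector `∂ᵢ F` of a map `F` at `x`. -/
def tangentVec (F : (ι → ℝ) → (κ → ℝ)) (x : ι → ℝ) (i : ι) : κ → ℝ :=
  fun c => pd i (fun z => F z c) x

/-- The induced metric `F^* g` at `x`, in coordinates. -/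
def inducedMetric (g : (κ → ℝ) → Matrix κ κ ℝ) (F : (ι → ℝ) → (κ → ℝ)) (x : ι → ℝ) :
    Matrix ι ι ℝ :=
  Matrix.of fun i j => scal g (F x) (tangentVec F x i) (tangentVec F x j)

/-- The normal component `V^⊥` along the immersion `F` of an ambient vector `V` at `F x`
(meaningful where the induced metric is non-degenerate). -/
def normalPart (g : (κ → ℝ) → Matrix κ κ ℝ) (F : (ι → ℝ) → (κ → ℝ)) (x : ι → ℝ)
    (V : κ → ℝ) : κ → ℝ :=
  V - ∑ i, ∑ j,
    ((inducedMetric g F x)⁻¹ i j * scal g (F x) V (tangentVec F x i)) • tangentVec F x j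

/-- The ambient covariant derivative `∇_{∂ᵢ} (∂ⱼ F)` along `F`, at `x`. -/
def covDeriv (g : (κ → ℝ) → Matrix κ κ ℝ) (F : (ι → ℝ) → (κ → ℝ)) (x : ι → ℝ) (i j : ι) :
    κ → ℝ :=
  fun c => pd i (fun z => tangentVec F z j c) x +
    ∑ a, ∑ b, christoffel g (F x) c a b * tangentVec F x i a * tangentVec F x j b

/-- The second fundamental form `II(∂ᵢ, ∂ⱼ)` of `F` at `x`. -/
def secondFundForm (g : (κ → ℝ) → Matrix κ κ ℝ) (F : (ι → ℝ) → (κ → ℝ)) (x : ι → ℝ)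
    (i j : ι) : κ → ℝ :=
  normalPart g F x (covDeriv g F x i j)

/-- The mean curvature vector of `F` at `x`: the trace of the second fundamental form with
respect to the induced metric. -/
def meanCurvatureVector (g : (κ → ℝ) → Matrix κ κ ℝ) (F : (ι → ℝ) → (κ → ℝ)) (x : ι → ℝ) :
    κ → ℝ :=
  ∑ i, ∑ j, (inducedMetric g F x)⁻¹ i j • secondFundForm g F x i j

end PseudoRiemannian

/-! ### Graphs in `ℍⁿ ×₋₁ ℝ`

The half-space coordinates `x₁, …, xₙ` are indexed by `Fin n`, so that `x₁` is `x 0`; the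
coordinates of `ℍⁿ × ℝ` are indexed by `Fin n ⊕ Unit`, the last one being the time `t`. -/

/-- The half-space model of `ℍⁿ`. -/
def halfSpace (n : ℕ) [NeZero n] : Set (Fin n → ℝ) := {x | 0 < x 0}

/-- The Lorentzian metric `x₁⁻² (dx₁² + ⋯ + dxₙ²) - dt²` on `ℍⁿ × ℝ`. -/
def metric (n : ℕ) [NeZero n] (y : Fin n ⊕ Unit → ℝ) :
    Matrix (Fin n ⊕ Unit) (Fin n ⊕ Unit) ℝ :=
  Matrix.diagonal (Sum.elim (fun _ => 1 / (y (Sum.inl 0)) ^ 2) (fun _ => -1))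

/-- The coordinate field `∂ₜ`. -/
def timeField (n : ℕ) : Fin n ⊕ Unit → ℝ := Pi.single (Sum.inr ()) 1

/-- The graph map `p ↦ (p, u p)`. -/
def graphMap {n : ℕ} (u : (Fin n → ℝ) → ℝ) (x : Fin n → ℝ) : Fin n ⊕ Unit → ℝ :=
  Sum.elim x (fun _ => u x)

/-- The graph of `u` over `Ω` is space-like: the induced metric is positive definite. -/
def IsSpacelike {n : ℕ} [NeZero n] (Ω : Set (Fin n → ℝ)) (u : (Fin n → ℝ) → ℝ) : Prop :=
  ∀ x ∈ Ω, (inducedMetric (metric n) (graphMap u) x).PosDef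

/-- The graph of `u` over `Ω` is a translator: `H = ∂ₜ^⊥`. -/
def IsTranslator {n : ℕ} [NeZero n] (Ω : Set (Fin n → ℝ)) (u : (Fin n → ℝ) → ℝ) : Prop :=
  ∀ x ∈ Ω, meanCurvatureVector (metric n) (graphMap u) x =
    normalPart (metric n) (graphMap u) x (timeField n)

/-! ### Horospheres -/

/-- The horosphere `{x₁ = c}` (for `c > 0`). -/
def horosphere (n : ℕ) [NeZero n] (c : ℝ) : Set (Fin n → ℝ) := {x | x 0 = c}

/-- The graph of `u` over `Ω` is foliated by horospheres: through each of its points there is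
a horosphere `{x₁ = c} × {t}` that is contained in the graph. -/
def FoliatedByHorospheres {n : ℕ} [NeZero n] (Ω : Set (Fin n → ℝ)) (u : (Fin n → ℝ) → ℝ) :
    Prop :=
  ∀ z ∈ Ω.graphOn u, ∃ c > 0, ∃ t : ℝ,
    z ∈ horosphere n c ×ˢ {t} ∧ horosphere n c ×ˢ {t} ⊆ Ω.graphOn u

/-- The function `ρ = - ln x₁`, whose level sets are the horospheres `{x₁ = c}`, with the sign
for which `div (∇ρ) = n - 1`. -/
def rho {n : ℕ} [NeZero n] (x : Fin n → ℝ) : ℝ := -Real.log (x 0)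

/-! ### The profiles -/

/-- An antiderivative of `1 / ((1 - x²) (1 - x))`. -/
def P (x : ℝ) : ℝ :=
  -(1 / 4) * Real.log |1 - x| + 1 / 2 * (1 / (1 - x)) + 1 / 4 * Real.log |1 + x|

/-- An antiderivative of `1 / ((1 - x²) (1 - m x))`, for `m > 1`. -/
def Q (m x : ℝ) : ℝ :=
  1 / (2 * m - 2) * Real.log |1 - x| + 1 / (2 * m + 2) * Real.log |1 + x| -
    m / (m ^ 2 - 1) * Real.log |1 - m * x|

/-- `w : ℝ → J` is the two-sided inverse of the restriction `h|_J : J → ℝ`. -/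
def IsInverseOn (h : ℝ → ℝ) (J : Set ℝ) (w : ℝ → ℝ) : Prop :=
  MapsTo w univ J ∧ InvOn w h J univ

/-- `f(s) = ∫_{s₀}^s (h|_J)⁻¹(r - s₀) dr + f₀` for some constants `s₀`, `f₀`, where
`h|_J : J → ℝ` is bijective. -/
def IsPrimitiveOfInverse (h : ℝ → ℝ) (J : Set ℝ) (f : ℝ → ℝ) : Prop :=
  ∃ w : ℝ → ℝ, IsInverseOn h J w ∧
    ∃ s₀ f₀ : ℝ, ∀ s, f s = (∫ r in s₀..s, w (r - s₀)) + f₀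

/-- The list of profile functions. -/
def IsProfile (n : ℕ) (f : ℝ → ℝ) : Prop :=
  (2 < n ∧ ∃ f₀ : ℝ, ∀ s, f s = s / ((n : ℝ) - 1) + f₀) ∨
  (n = 2 ∧ IsPrimitiveOfInverse P (Ioo (-1) 1) f) ∨
  (2 < n ∧ IsPrimitiveOfInverse (Q ((n : ℝ) - 1)) (Ioo (-1) (1 / ((n : ℝ) - 1))) f) ∨
  (2 < n ∧ IsPrimitiveOfInverse (Q ((n : ℝ) - 1)) (Ioo (1 / ((n : ℝ) - 1)) 1) f)

/-- `u : Ω → ℝ` is the function `f ∘ ρ : ρ⁻¹(I) → ℝ` for an open interval `I` and a `C²`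
function `f` of the list (the members of the list are defined on the whole line). -/
def HasListedProfile {n : ℕ} [NeZero n] (Ω : Set (Fin n → ℝ)) (u : (Fin n → ℝ) → ℝ) : Prop :=
  ∃ I : Set ℝ, IsOpen I ∧ I.OrdConnected ∧ Ω = {x ∈ halfSpace n | rho x ∈ I} ∧
    ∃ f : ℝ → ℝ, ContDiff ℝ 2 f ∧ IsProfile n f ∧ ∀ x ∈ Ω, u x = f (rho x)

end HESU

end

/-! ### Metric, Christoffel symbols and covariant derivative along a graph. -/

noncomputable section

namespace HESU

variable {n : ℕ}

/-! Foliation by horospheres says that `Ω` is a union of level sets of `ρ` and that `u` is constant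
on each of them (`foliatedByHorospheres_iff`). Hence `u = g ∘ ρ` over `ρ⁻¹(I)`, and `I = ρ(Ω)` is an
interval because `Ω` is connected.

For such a `u`, put `p = g'`, `q = g''` and `m = n - 1`. The induced metric is diagonal, with entry
`(1 - p²)/x₁²` in the direction of `x₁` and `1/x₁²` in the others, so space-like means `p² < 1`.
Modulo tangent vectors, the trace of the second covariant derivative is `(q/(1 - p²) + m p) ∂ₜ`.
Since `∂ₜ^⊥ ≠ 0`, the translator equation is the scalar equation `q = (1 - p²)(1 - m p)`
(`RadialJet.translator_iff`).

So `w = g'` solves the autonomous equation `w' = (1 - w²)(1 - m w)` with values in `(-1, 1)`. If `m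
= 1` there is no stationary value in `(-1, 1)`. If `m > 1` the only one is `1/m`, and by uniqueness
a solution is either constantly `1/m` or stays on one side of it (`exists_isProfile`). Away from
stationary values, separation of variables gives `h (w s) = s + a` with `h = P` or `h = Q`, so `w`
is a translate of the inverse of a branch of `h`. Each branch maps onto the line, so the listed
profiles are global solutions, and the converse follows from the same scalar equation. -/

theorem pd_apply (i k : Fin n) (x : Fin n → ℝ) :
    pd i (fun z : Fin n → ℝ => z k) x = (Pi.single i 1 : Fin n → ℝ) k := by
  unfold pd
  rw [(hasFDerivAt_apply k x).fderiv]
  rfl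

theorem pd_const {ι : Type*} [Fintype ι] [DecidableEq ι] (i : ι) (a : ℝ) (x : ι → ℝ) :
    pd i (fun _ => a) x = 0 := by
  simp [pd]

theorem tangentVec_graphMap (u : (Fin n → ℝ) → ℝ) (x : Fin n → ℝ) (i : Fin n) :
    tangentVec (graphMap u) x i = Sum.elim (Pi.single i 1) (fun _ => pd i u x) := by
  ext (k | k)
  · simpa [tangentVec, graphMap] using pd_apply i k x
  · simp [tangentVec, graphMap]

variable [NeZero n]

theorem scal_metric (y V W : Fin n ⊕ Unit → ℝ) :
    scal (metric n) y V W =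
      (∑ k, V (Sum.inl k) * W (Sum.inl k)) / y (Sum.inl 0) ^ 2 -
        V (Sum.inr ()) * W (Sum.inr ()) := by
  simp [scal, metric, Matrix.diagonal_apply, Fintype.sum_sum_type, Finset.sum_div]
  rw [sub_eq_add_neg]
  congr 1
  refine Finset.sum_congr rfl fun k _ => ?_
  ring

theorem inducedMetric_graphMap (u : (Fin n → ℝ) → ℝ) (x : Fin n → ℝ) :
    inducedMetric (metric n) (graphMap u) x =
      Matrix.of fun i j => (if i = j then 1 / x 0 ^ 2 else 0) - pd i u x * pd j u x := by
  ext i j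
  simp [inducedMetric, scal_metric, tangentVec_graphMap, graphMap, Pi.single_apply]
  split_ifs <;> simp_all

theorem metric_inv (y : Fin n ⊕ Unit → ℝ) (hy : y (Sum.inl 0) ≠ 0) :
    (metric n y)⁻¹ =
      Matrix.diagonal (Sum.elim (fun _ => y (Sum.inl 0) ^ 2) (fun _ => -1)) := by
  apply Matrix.inv_eq_left_inv
  rw [metric, Matrix.diagonal_mul_diagonal, ← Matrix.diagonal_one]
  congr 1
  ext (k | k)
  · simp; field_simp
  · simp

/-- The partial derivatives of the coefficients of the metric. -/
theorem pd_metric (y : Fin n ⊕ Unit → ℝ) (hy : y (Sum.inl 0) ≠ 0) (a b d : Fin n ⊕ Unit) :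
    pd a (fun z => metric n z b d) y =
      if a = Sum.inl 0 ∧ b = d ∧ b ≠ Sum.inr () then -2 / y (Sum.inl 0) ^ 3 else 0 := by
  by_cases hbd : b = d
  · subst hbd
    rcases b with k | k
    · have h1 : HasFDerivAt (fun z : Fin n ⊕ Unit → ℝ => z (Sum.inl 0))
          (ContinuousLinearMap.proj (R := ℝ) (φ := fun _ => ℝ) (Sum.inl 0)) y :=
        hasFDerivAt_apply _ y
      have h2 : HasDerivAt (fun t : ℝ => 1 / t ^ 2) (-2 / y (Sum.inl 0) ^ 3) (y (Sum.inl 0)) := by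
        have := ((hasDerivAt_pow 2 (y (Sum.inl 0))).fun_inv (pow_ne_zero 2 hy))
        simp only [one_div]
        refine this.congr_deriv ?_
        simp
        field_simp
      have h3 := h2.comp_hasFDerivAt y h1
      have h4 : (fun z : Fin n ⊕ Unit → ℝ => metric n z (Sum.inl k) (Sum.inl k)) =
          (fun t : ℝ => 1 / t ^ 2) ∘ fun z : Fin n ⊕ Unit → ℝ => z (Sum.inl 0) := by
        ext z; simp [metric]
      rw [h4, pd, h3.fderiv]
      simp [Pi.single_apply, eq_comm]
    · have : (fun z : Fin n ⊕ Unit → ℝ => metric n z (Sum.inr k) (Sum.inr k)) =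
          fun _ => (-1 : ℝ) := by
        ext z; simp [metric]
      rw [this, pd_const]; simp
  · have : (fun z : Fin n ⊕ Unit → ℝ => metric n z b d) = fun _ => (0 : ℝ) := by
      ext z; simp [metric, hbd]
    rw [this, pd_const]; simp [hbd]

theorem christoffel_metric_space (y : Fin n ⊕ Unit → ℝ) (hy : y (Sum.inl 0) ≠ 0)
    (k i j : Fin n) :
    christoffel (metric n) y (Sum.inl k) (Sum.inl i) (Sum.inl j) =
      -(1 / y (Sum.inl 0)) * ((if i = 0 ∧ j = k then 1 else 0) +
        (if j = 0 ∧ i = k then 1 else 0) - (if k = 0 ∧ i = j then 1 else 0)) := by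
  simp only [christoffel, metric_inv y hy, pd_metric y hy, Matrix.diagonal_apply]
  rw [Finset.sum_eq_single (Sum.inl k)]
  · simp
    split_ifs <;> field_simp <;> ring
  · intro d _ hd
    simp [hd.symm]
  · simp

/-- The metric is a product: no coefficient depends on `t`, and the `dt²` coefficient is constant.
-/
theorem christoffel_metric_of_time (y : Fin n ⊕ Unit → ℝ) (hy : y (Sum.inl 0) ≠ 0)
    (c a b : Fin n ⊕ Unit) (h : c = Sum.inr () ∨ a = Sum.inr () ∨ b = Sum.inr ()) :
    christoffel (metric n) y c a b = 0 := by
  simp only [christoffel, metric_inv y hy, pd_metric y hy, Matrix.diagonal_apply]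
  rw [Finset.sum_eq_single c]
  · rcases h with rfl | rfl | rfl
    · rcases a with a | a <;> rcases b with b | b <;> simp
    · rcases c with a | a <;> rcases b with b | b <;> simp
    · rcases c with a | a <;> rcases a with b | b <;> simp
  · intro d _ hd
    simp [hd.symm]
  · simp

theorem covDeriv_graphMap (u : (Fin n → ℝ) → ℝ) (x : Fin n → ℝ) (hx : x 0 ≠ 0)
    (i j : Fin n) :
    covDeriv (metric n) (graphMap u) x i j =
      Sum.elim (fun k => -(1 / x 0) * ((if i = 0 ∧ j = k then 1 else 0) +
        (if j = 0 ∧ i = k then 1 else 0) - (if k = 0 ∧ i = j then 1 else 0)))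
        (fun _ => pd i (pd j u) x) := by
  have hy : graphMap u x (Sum.inl 0) ≠ 0 := by simpa [graphMap] using hx
  ext (k | k)
  · simp only [covDeriv, tangentVec_graphMap, Sum.elim_inl, Fintype.sum_sum_type, pd_const,
      Finset.univ_unique, Finset.sum_singleton, zero_add, Sum.elim_inr]
    simp [christoffel_metric_space _ hy, christoffel_metric_of_time _ hy, Pi.single_apply]
    simp [graphMap]
  · simp only [covDeriv, tangentVec_graphMap, Sum.elim_inr]
    simp [christoffel_metric_of_time _ hy]

/-! ### Normal projection and the mean curvature vector. -/

theorem scal_add_smul (y V W X : Fin n ⊕ Unit → ℝ) (a : ℝ) :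
    scal (metric n) y (a • V + W) X =
      a * scal (metric n) y V X + scal (metric n) y W X := by
  simp only [scal_metric, Pi.add_apply, Pi.smul_apply, smul_eq_mul, add_mul,
    Finset.sum_add_distrib, mul_assoc, ← Finset.mul_sum]
  ring

/-- The normal projection, as a linear map. -/
def normalPartLinear (F : (Fin n → ℝ) → (Fin n ⊕ Unit → ℝ)) (x : Fin n → ℝ) :
    (Fin n ⊕ Unit → ℝ) →ₗ[ℝ] (Fin n ⊕ Unit → ℝ) where
  toFun := normalPart (metric n) F x
  map_add' V W := by
    have h := fun X => scal_add_smul (F x) V W X 1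
    simp only [one_smul, one_mul] at h
    simp only [normalPart, h, mul_add, add_smul, Finset.sum_add_distrib]
    abel
  map_smul' a V := by
    have h := fun X => scal_add_smul (F x) V 0 X a
    have h0 : ∀ X, scal (metric n) (F x) 0 X = 0 := fun X => by simp [scal]
    simp only [add_zero, h0] at h
    simp only [normalPart, h, RingHom.id_apply, smul_sub, Finset.smul_sum, smul_smul]
    congr 1
    refine Finset.sum_congr rfl fun i _ => Finset.sum_congr rfl fun j _ => ?_
    congr 1
    ring

theorem normalPartLinear_apply (F : (Fin n → ℝ) → (Fin n ⊕ Unit → ℝ)) (x : Fin n → ℝ)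
    (V : Fin n ⊕ Unit → ℝ) : normalPartLinear F x V = normalPart (metric n) F x V := rfl

/-- The inverse Gram matrix times the Gram matrix is the identity, so the subtracted sum is the
tangent vector itself. -/
theorem normalPart_tangentVec (F : (Fin n → ℝ) → (Fin n ⊕ Unit → ℝ)) (x : Fin n → ℝ)
    (h : IsUnit (inducedMetric (metric n) F x).det) (k : Fin n) :
    normalPart (metric n) F x (tangentVec F x k) = 0 := by
  have h1 : ∀ j, ∑ i, (inducedMetric (metric n) F x)⁻¹ i j *
      scal (metric n) (F x) (tangentVec F x k) (tangentVec F x i) =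
      (1 : Matrix (Fin n) (Fin n) ℝ) k j := by
    intro j
    rw [← Matrix.mul_nonsing_inv _ h, Matrix.mul_apply]
    exact Finset.sum_congr rfl fun i _ => mul_comm _ _
  rw [normalPart, Finset.sum_comm]
  simp_rw [← Finset.sum_smul, h1, Matrix.one_apply]
  simp

/-- By linearity the trace can be taken before projecting, so that tangent parts of the trace can be
discarded. -/
theorem meanCurvatureVector_eq (F : (Fin n → ℝ) → (Fin n ⊕ Unit → ℝ)) (x : Fin n → ℝ) :
    meanCurvatureVector (metric n) F x = normalPart (metric n) F x
      (∑ i, ∑ j, (inducedMetric (metric n) F x)⁻¹ i j • covDeriv (metric n) F x i j) := by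
  simp only [← normalPartLinear_apply, map_sum, map_smul]
  rfl

/-- First and second derivatives at `x` of a function of the form `f ∘ ρ`, with
`p = f' (ρ x)` and `q = f'' (ρ x)`. -/
structure RadialJet (u : (Fin n → ℝ) → ℝ) (x : Fin n → ℝ) (p q : ℝ) : Prop where
  first : ∀ i, pd i u x = if i = 0 then -p / x 0 else 0
  second : ∀ i, pd i (pd i u) x = if i = 0 then (q + p) / x 0 ^ 2 else 0

/-! ### Graphs of functions of `ρ`: the translator equation becomes an ODE. -/

variable {u : (Fin n → ℝ) → ℝ} {x : Fin n → ℝ} {p q : ℝ}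

/-- Because this matrix is diagonal, mixed second derivatives drop out of the trace; `RadialJet`
therefore records only the pure ones. -/
theorem RadialJet.inducedMetric_eq (h : RadialJet u x p q) :
    inducedMetric (metric n) (graphMap u) x =
      Matrix.diagonal fun i => (if i = 0 then 1 - p ^ 2 else 1) / x 0 ^ 2 := by
  rw [inducedMetric_graphMap]
  ext i j
  simp only [Matrix.of_apply, h.first, Matrix.diagonal_apply]
  split_ifs <;> simp_all
  ring

theorem RadialJet.posDef_iff (h : RadialJet u x p q) (hx : 0 < x 0) :
    (inducedMetric (metric n) (graphMap u) x).PosDef ↔ p ^ 2 < 1 := by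
  rw [h.inducedMetric_eq, Matrix.posDef_diagonal_iff]
  constructor
  · intro H
    have := H 0
    rw [if_pos rfl, div_pos_iff_of_pos_right (by positivity)] at this
    linarith
  · intro H i
    split_ifs
    · exact div_pos (by linarith) (by positivity)
    · positivity

theorem RadialJet.inducedMetric_inv (h : RadialJet u x p q) (hx : 0 < x 0) (hp : p ^ 2 < 1) :
    (inducedMetric (metric n) (graphMap u) x)⁻¹ =
      Matrix.diagonal fun i => x 0 ^ 2 / (if i = 0 then 1 - p ^ 2 else 1) := by
  apply Matrix.inv_eq_left_inv
  rw [h.inducedMetric_eq, Matrix.diagonal_mul_diagonal, ← Matrix.diagonal_one]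
  congr 1
  ext i
  have : 1 - p ^ 2 ≠ 0 := by linarith
  split_ifs <;> field_simp

/-- The trace of the ambient second derivative of the graph map, decomposed into a tangent part
and a multiple of `∂ₜ`. -/
theorem RadialJet.trace_covDeriv (h : RadialJet u x p q) (hx : 0 < x 0) (hp : p ^ 2 < 1) :
    ∑ i, ∑ j, (inducedMetric (metric n) (graphMap u) x)⁻¹ i j •
        covDeriv (metric n) (graphMap u) x i j =
      (-x 0 * (1 / (1 - p ^ 2) - ((n : ℝ) - 1))) • tangentVec (graphMap u) x 0 +
        (q / (1 - p ^ 2) + ((n : ℝ) - 1) * p) • timeField n := by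
  have hp' : 1 - p ^ 2 ≠ 0 := by linarith
  -- One direction is transverse to the horosphere; the other `n - 1` are tangent to it.
  have hsum : ∑ i : Fin n, x 0 ^ 2 / (if i = 0 then 1 - p ^ 2 else 1) =
      x 0 ^ 2 / (1 - p ^ 2) + ((n : ℝ) - 1) * x 0 ^ 2 := by
    have : ∀ i : Fin n, x 0 ^ 2 / (if i = 0 then 1 - p ^ 2 else 1) =
        (if i = 0 then x 0 ^ 2 / (1 - p ^ 2) - x 0 ^ 2 else 0) + x 0 ^ 2 := by
      intro i; split_ifs <;> simp
    simp_rw [this, Finset.sum_add_distrib]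
    simp
    ring
  simp_rw [h.inducedMetric_inv hx hp, Matrix.diagonal_apply, ite_smul, zero_smul,
    Finset.sum_ite_eq, Finset.mem_univ, if_true, covDeriv_graphMap u x hx.ne',
    tangentVec_graphMap]
  ext (k | k)
  · simp only [Finset.sum_apply, Pi.smul_apply, Sum.elim_inl, smul_eq_mul, Pi.add_apply,
      timeField]
    have e : ∀ i : Fin n, x 0 ^ 2 / (if i = 0 then 1 - p ^ 2 else 1) *
        (-(1 / x 0) * ((if i = 0 ∧ i = k then 1 else 0) +
        (if i = 0 ∧ i = k then 1 else 0) - (if k = 0 ∧ True then 1 else 0))) =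
        (if i = 0 then (if k = 0 then -2 * x 0 / (1 - p ^ 2) else 0) else 0) +
        (if k = 0 then 1 / x 0 else 0) *
          (x 0 ^ 2 / (if i = 0 then 1 - p ^ 2 else 1)) := by
      intro i
      by_cases hi : i = 0 <;> by_cases hk : k = 0
      · subst hi hk; simp; field_simp; ring
      · subst hi; simp [hk, Ne.symm hk]
      · simp [hi, hk, mul_comm]
      · simp [hi, hk]
    rw [Finset.sum_congr rfl fun i _ => e i, Finset.sum_add_distrib, ← Finset.mul_sum, hsum]
    by_cases hk : k = 0
    · subst hk; simp; field_simp; ring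
    · simp [hk]
  · simp [timeField, h.first, h.second]
    field_simp
    ring

/-- The time component of `∂ₜ^⊥` is `1 + p²/(1 - p²)`, which is positive. -/
theorem RadialJet.normalPart_timeField_ne_zero (h : RadialJet u x p q) (hx : 0 < x 0)
    (hp : p ^ 2 < 1) :
    normalPart (metric n) (graphMap u) x (timeField n) ≠ 0 := by
  intro H
  have H1 := congrFun H (Sum.inr ())
  have hp' : 0 < 1 - p ^ 2 := by linarith
  simp [normalPart, h.inducedMetric_inv hx hp, Matrix.diagonal_apply, scal_metric,
    tangentVec_graphMap, timeField, h.first] at H1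
  have : 0 ≤ x 0 ^ 2 / (1 - p ^ 2) * (-p / x 0) * (-p / x 0) := by
    rw [mul_assoc]; exact mul_nonneg (by positivity) (mul_self_nonneg _)
  linarith

/-- Both sides are multiples of the nonzero vector `∂ₜ^⊥`, so the coefficients `q/(1 - p²) + (n - 1)
p` and `1` are compared. -/
theorem RadialJet.translator_iff (h : RadialJet u x p q) (hx : 0 < x 0) (hp : p ^ 2 < 1) :
    meanCurvatureVector (metric n) (graphMap u) x =
      normalPart (metric n) (graphMap u) x (timeField n) ↔
    q = (1 - p ^ 2) * (1 - ((n : ℝ) - 1) * p) := by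
  have hp' : 1 - p ^ 2 ≠ 0 := by linarith
  have hdet : IsUnit (inducedMetric (metric n) (graphMap u) x).det :=
    (((h.posDef_iff hx).2 hp).det_pos).ne'.isUnit
  rw [meanCurvatureVector_eq, h.trace_covDeriv hx hp, ← normalPartLinear_apply, map_add,
    map_smul, map_smul, normalPartLinear_apply, normalPart_tangentVec _ _ hdet, smul_zero,
    zero_add, normalPartLinear_apply, ← sub_eq_zero]
  nth_rewrite 2 [← one_smul ℝ (normalPart (metric n) (graphMap u) x (timeField n))]
  rw [← sub_smul, smul_eq_zero, or_iff_left (h.normalPart_timeField_ne_zero hx hp)]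
  constructor
  · intro H
    field_simp at H
    linarith
  · intro H
    rw [H]
    field_simp
    ring

end HESU

end

noncomputable section

namespace HESU

open Filter Topology

/-! ### The profile equation `w' = (1 - w²) (1 - m w)` -/

/-- The right-hand side of the profile equation. -/
def profileField (m x : ℝ) : ℝ := (1 - x ^ 2) * (1 - m * x)

theorem hasStrictDerivAt_log_abs_one_sub_mul (a x : ℝ) (h : 1 - a * x ≠ 0) :
    HasStrictDerivAt (fun y => Real.log |1 - a * y|) (-a / (1 - a * x)) x := by
  simp only [Real.log_abs]
  have h1 : HasStrictDerivAt (fun y => 1 - a * y) (-a) x := by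
    simpa using ((hasStrictDerivAt_id x).const_mul a).const_sub 1
  exact h1.log h

/-- For `m = 1` the factor `1 - x` is doubled, whence the rational term in `P`. Strict
differentiability is what makes the inverse continuous in `IsInverseOn.hasDerivAt`. -/
theorem hasStrictDerivAt_P {x : ℝ} (hx : x ∈ Ioo (-1 : ℝ) 1) :
    HasStrictDerivAt P (profileField 1 x)⁻¹ x := by
  have h1 : 1 - x ≠ 0 := by linarith [hx.2]
  have h2 : 1 + x ≠ 0 := by linarith [hx.1]
  have d1 := hasStrictDerivAt_log_abs_one_sub_mul 1 x (by simpa using h1)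
  have d2 := hasStrictDerivAt_log_abs_one_sub_mul (-1) x (by simpa using h2)
  have d3 : HasStrictDerivAt (fun y : ℝ => (1 - y)⁻¹) (-((1 - x) ^ 2)⁻¹ * -1) x :=
    (hasStrictDerivAt_inv h1).comp x ((hasStrictDerivAt_id x).const_sub 1)
  have := ((d1.const_mul (-(1 / 4))).add (d3.const_mul (1 / 2))).add (d2.const_mul (1 / 4))
  simp only [one_mul, neg_mul, sub_neg_eq_add, neg_neg] at this
  unfold P
  simp only [one_div, neg_mul] at this ⊢
  refine this.congr_deriv ?_
  rw [profileField, show (1 - x ^ 2) * (1 - 1 * x) = (1 - x) ^ 2 * (1 + x) by ring]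
  field_simp
  ring

theorem hasStrictDerivAt_Q {m x : ℝ} (hm : 1 < m) (hx : x ∈ Ioo (-1 : ℝ) 1)
    (hmx : 1 - m * x ≠ 0) :
    HasStrictDerivAt (Q m) (profileField m x)⁻¹ x := by
  have h1 : 1 - x ≠ 0 := by linarith [hx.2]
  have h2 : 1 + x ≠ 0 := by linarith [hx.1]
  have m1 : m - 1 ≠ 0 := by linarith
  have m2 : m + 1 ≠ 0 := by linarith
  have d1 := hasStrictDerivAt_log_abs_one_sub_mul 1 x (by simpa using h1)
  have d2 := hasStrictDerivAt_log_abs_one_sub_mul (-1) x (by simpa using h2)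
  have d3 := hasStrictDerivAt_log_abs_one_sub_mul m x hmx
  have := ((d1.const_mul (1 / (2 * m - 2))).add (d2.const_mul (1 / (2 * m + 2)))).sub
    (d3.const_mul (m / (m ^ 2 - 1)))
  simp only [one_mul, neg_mul, sub_neg_eq_add, neg_neg] at this
  unfold Q
  refine this.congr_deriv ?_
  rw [profileField, show (1 - x ^ 2) * (1 - m * x) = (1 - x) * (1 + x) * (1 - m * x) by ring,
    show 2 * m - 2 = 2 * (m - 1) by ring, show 2 * m + 2 = 2 * (m + 1) by ring,
    show m ^ 2 - 1 = (m - 1) * (m + 1) by ring]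
  field_simp
  ring

/-- A function on an interval with non-vanishing derivative is injective. -/
theorem injOn_of_hasDerivAt_ne_zero {h h' : ℝ → ℝ} {J : Set ℝ} (hJ : J.OrdConnected)
    (hd : ∀ x ∈ J, HasDerivAt h (h' x) x) (h0 : ∀ x ∈ J, h' x ≠ 0) : InjOn h J := by
  have key : ∀ a ∈ J, ∀ b ∈ J, a < b → h a ≠ h b := by
    intro a ha b hb hab heq
    have hsub : Icc a b ⊆ J := hJ.out ha hb
    obtain ⟨c, hc, hc0⟩ := exists_hasDerivAt_eq_zero hab
      (fun x hx => (hd x (hsub hx)).continuousAt.continuousWithinAt) heq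
      (fun x hx => hd x (hsub (Ioo_subset_Icc_self hx)))
    exact h0 c (hsub (Ioo_subset_Icc_self hc)) hc0
  intro a ha b hb heq
  rcases lt_trichotomy a b with h | h | h
  · exact (key a ha b hb h heq).elim
  · exact h
  · exact (key b hb a ha h heq.symm).elim

theorem exists_isInverseOn {h : ℝ → ℝ} {J : Set ℝ} (hb : BijOn h J univ) :
    ∃ w, IsInverseOn h J w := by
  refine ⟨Function.invFunOn h J, ?_, ?_⟩
  · exact hb.surjOn.mapsTo_invFunOn
  · exact hb.invOn_invFunOn

/-- The inverse of an antiderivative of `1 / v` solves `w' = v w`. -/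
theorem IsInverseOn.hasDerivAt {h v w : ℝ → ℝ} {J : Set ℝ} (hw : IsInverseOn h J w)
    (hJ : IsOpen J) (hd : ∀ x ∈ J, HasStrictDerivAt h (v x)⁻¹ x) (hv : ∀ x ∈ J, v x ≠ 0)
    (s : ℝ) : HasDerivAt w (v (w s)) s := by
  have hws : w s ∈ J := hw.1 (mem_univ s)
  have hr : ∀ t, h (w t) = t := fun t => hw.2.2 (mem_univ t)
  -- A nonzero strict derivative makes `h` carry neighbourhoods of `w s` onto neighbourhoods of `s`,
  -- and `w ∘ h` is the identity on `J`.
  have hc : ContinuousAt w s := by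
    have hmap := (hd _ hws).map_nhds_eq (inv_ne_zero (hv _ hws))
    rw [hr] at hmap
    rw [ContinuousAt, ← hmap, tendsto_map'_iff]
    refine tendsto_id.congr' ?_
    filter_upwards [hJ.mem_nhds hws] with x hx
    exact (hw.2.1 hx).symm
  have := (hd _ hws).hasDerivAt.of_local_left_inverse hc (inv_ne_zero (hv _ hws))
    (Eventually.of_forall hr)
  rwa [inv_inv] at this

/-! ### Limits of `P` and `Q` at the ends of their branches. -/

theorem tendsto_log_abs_one_sub_mul {a b : ℝ} (ha : a ≠ 0) (hab : a * b = 1) :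
    Tendsto (fun x => Real.log |1 - a * x|) (𝓝[≠] b) atBot := by
  simp only [Real.log_abs]
  refine Real.tendsto_log_nhdsNE_zero.comp ?_
  refine tendsto_nhdsWithin_iff.2 ⟨?_, ?_⟩
  · have : ContinuousAt (fun x : ℝ => 1 - a * x) b := by fun_prop
    have h := this.tendsto
    rw [hab, sub_self] at h
    exact h.mono_left nhdsWithin_le_nhds
  · filter_upwards [self_mem_nhdsWithin] with x hx h0
    apply hx
    have : a * x = a * b := by
      have h0' : 1 - a * x = 0 := h0
      linarith
    exact mul_left_cancel₀ ha this

theorem tendsto_P_one : Tendsto P (𝓝[<] 1) atTop := by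
  have hle : 𝓝[<] (1 : ℝ) ≤ 𝓝[≠] 1 := nhdsLT_le_nhdsNE 1
  have h1 := (tendsto_log_abs_one_sub_mul (a := 1) (b := 1) one_ne_zero (by norm_num)).mono_left hle
  have h2 : Tendsto (fun x : ℝ => (1 - x)⁻¹) (𝓝[<] 1) atTop := by
    refine tendsto_inv_nhdsGT_zero.comp (tendsto_nhdsWithin_iff.2 ⟨?_, ?_⟩)
    · have : ContinuousAt (fun x : ℝ => 1 - x) 1 := by fun_prop
      have h := this.tendsto
      rw [sub_self] at h
      exact h.mono_left nhdsWithin_le_nhds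
    · filter_upwards [self_mem_nhdsWithin] with x hx
      exact sub_pos.2 (mem_Iio.1 hx)
  have h3 := (hasStrictDerivAt_log_abs_one_sub_mul (-1) 1 (by norm_num)).hasDerivAt.continuousAt
  have h3' := h3.tendsto.mono_left (nhdsWithin_le_nhds (s := Iio (1 : ℝ)))
  have := ((h1.const_mul_atBot_of_neg (show -(1 / 4 : ℝ) < 0 by norm_num)).atTop_add_atTop
    (h2.const_mul_atTop (show (0 : ℝ) < 1 / 2 by norm_num))).atTop_add (h3'.const_mul (1 / 4))
  refine this.congr fun x => ?_
  simp [P]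

theorem tendsto_P_neg_one : Tendsto P (𝓝[>] (-1)) atBot := by
  have hle : 𝓝[>] (-1 : ℝ) ≤ 𝓝[≠] (-1) := nhdsGT_le_nhdsNE (-1)
  have h1 := (tendsto_log_abs_one_sub_mul (a := -1) (b := -1) (by norm_num)
    (by norm_num)).mono_left hle
  have h2 : ContinuousAt (fun x : ℝ => -(1 / 4) * Real.log |1 - 1 * x| + 1 / 2 * (1 / (1 - x)))
      (-1) := by
    have := (hasStrictDerivAt_log_abs_one_sub_mul 1 (-1) (by norm_num)).hasDerivAt.continuousAt
    refine (this.const_mul _).add (ContinuousAt.const_mul ?_ _)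
    exact ContinuousAt.div (by fun_prop) (by fun_prop) (by norm_num)
  have := (h2.tendsto.mono_left (nhdsWithin_le_nhds (s := Ioi (-1 : ℝ)))).add_atBot
    (h1.const_mul_atBot (show (0 : ℝ) < 1 / 4 by norm_num))
  refine this.congr fun x => ?_
  simp [P]

theorem tendsto_Q_neg_one {m : ℝ} (hm : 1 < m) : Tendsto (Q m) (𝓝[>] (-1)) atBot := by
  have hle : 𝓝[>] (-1 : ℝ) ≤ 𝓝[≠] (-1) := nhdsGT_le_nhdsNE (-1)
  have h1 := (tendsto_log_abs_one_sub_mul (a := -1) (b := -1) (by norm_num)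
    (by norm_num)).mono_left hle
  have c1 := (hasStrictDerivAt_log_abs_one_sub_mul 1 (-1) (by norm_num)).hasDerivAt.continuousAt
  have c2 := (hasStrictDerivAt_log_abs_one_sub_mul m (-1) (by linarith)).hasDerivAt.continuousAt
  have c := (c1.const_mul (1 / (2 * m - 2))).sub (c2.const_mul (m / (m ^ 2 - 1)))
  have := (c.tendsto.mono_left (nhdsWithin_le_nhds (s := Ioi (-1 : ℝ)))).add_atBot
    (h1.const_mul_atBot (show 0 < 1 / (2 * m + 2) from div_pos one_pos (by linarith)))
  refine this.congr fun x => ?_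
  simp [Q]
  ring

theorem tendsto_Q_one {m : ℝ} (hm : 1 < m) : Tendsto (Q m) (𝓝[<] 1) atBot := by
  have hle : 𝓝[<] (1 : ℝ) ≤ 𝓝[≠] 1 := nhdsLT_le_nhdsNE 1
  have h1 := (tendsto_log_abs_one_sub_mul (a := 1) (b := 1) one_ne_zero (by norm_num)).mono_left hle
  have c1 := (hasStrictDerivAt_log_abs_one_sub_mul (-1) 1 (by norm_num)).hasDerivAt.continuousAt
  have c2 := (hasStrictDerivAt_log_abs_one_sub_mul m 1 (by linarith)).hasDerivAt.continuousAt
  have c := (c1.const_mul (1 / (2 * m + 2))).sub (c2.const_mul (m / (m ^ 2 - 1)))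
  have := (c.tendsto.mono_left (nhdsWithin_le_nhds (s := Iio (1 : ℝ)))).add_atBot
    (h1.const_mul_atBot (show 0 < 1 / (2 * m - 2) from div_pos one_pos (by linarith)))
  refine this.congr fun x => ?_
  simp [Q]
  ring

/-- Only the last logarithm diverges, and its coefficient is negative. With the limits `-∞` at `±1`,
this makes both branches of `Q` surjective. -/
theorem tendsto_Q_inv {m : ℝ} (hm : 1 < m) : Tendsto (Q m) (𝓝[≠] (1 / m)) atTop := by
  have hm0 : 0 < m := by linarith
  have him : 1 / m < 1 := (div_lt_one hm0).2 hm
  have him0 : 0 < 1 / m := by positivity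
  have h1 := tendsto_log_abs_one_sub_mul (a := m) (b := 1 / m) hm0.ne' (by field_simp)
  have c1 := (hasStrictDerivAt_log_abs_one_sub_mul 1 (1 / m) (by linarith)).hasDerivAt.continuousAt
  have c2 := (hasStrictDerivAt_log_abs_one_sub_mul (-1) (1 / m)
    (by linarith)).hasDerivAt.continuousAt
  have c := (c1.const_mul (1 / (2 * m - 2))).add (c2.const_mul (1 / (2 * m + 2)))
  have := (c.tendsto.mono_left (nhdsWithin_le_nhds (s := {1 / m}ᶜ))).add_atTop
    (h1.const_mul_atBot_of_neg (show -(m / (m ^ 2 - 1)) < 0 from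
      neg_lt_zero.2 (div_pos hm0 (by nlinarith))))
  refine this.congr fun x => ?_
  simp [Q]
  ring

/-- `J` is an open subinterval of `(-1, 1)` without zeros of the profile field, and `h` maps it
bijectively onto the line and has derivative `1 / profileField m` there. -/
structure IsProfileBranch (m : ℝ) (h : ℝ → ℝ) (J : Set ℝ) : Prop where
  isOpen : IsOpen J
  subset : J ⊆ Ioo (-1) 1
  ne_zero : ∀ x ∈ J, profileField m x ≠ 0
  deriv : ∀ x ∈ J, HasStrictDerivAt h (profileField m x)⁻¹ x
  bijOn : BijOn h J univ

theorem profileField_ne_zero {m x : ℝ} (hx : x ∈ Ioo (-1 : ℝ) 1) (hmx : 1 - m * x ≠ 0) :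
    profileField m x ≠ 0 := by
  refine mul_ne_zero ?_ hmx
  rw [show 1 - x ^ 2 = (1 - x) * (1 + x) by ring]
  exact mul_ne_zero (by linarith [hx.2]) (by linarith [hx.1])

theorem bijOn_univ_of_surjOn {h h' : ℝ → ℝ} {J : Set ℝ} (hJ : J.OrdConnected)
    (hd : ∀ x ∈ J, HasStrictDerivAt h (h' x)⁻¹ x) (h0 : ∀ x ∈ J, h' x ≠ 0)
    (hs : SurjOn h J univ) : BijOn h J univ :=
  ⟨mapsTo_univ _ _, injOn_of_hasDerivAt_ne_zero hJ (fun x hx => (hd x hx).hasDerivAt)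
    (fun x hx => inv_ne_zero (h0 x hx)), hs⟩

theorem isProfileBranch_P : IsProfileBranch 1 P (Ioo (-1) 1) := by
  have h0 : ∀ x ∈ Ioo (-1 : ℝ) 1, profileField 1 x ≠ 0 := fun x hx =>
    profileField_ne_zero hx (by linarith [hx.2])
  have hd : ∀ x ∈ Ioo (-1 : ℝ) 1, HasStrictDerivAt P (profileField 1 x)⁻¹ x := fun x hx =>
    hasStrictDerivAt_P hx
  refine ⟨isOpen_Ioo, subset_rfl, h0, hd, bijOn_univ_of_surjOn ordConnected_Ioo hd h0 ?_⟩
  refine ContinuousOn.surjOn_of_tendsto ⟨0, by norm_num⟩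
    (fun x hx => (hd x hx).hasDerivAt.continuousAt.continuousWithinAt) ?_ ?_
  · exact (tendsto_comp_coe_Ioo_atBot (by norm_num)).2 tendsto_P_neg_one
  · exact (tendsto_comp_coe_Ioo_atTop (by norm_num)).2 tendsto_P_one

theorem isProfileBranch_Q_lower {m : ℝ} (hm : 1 < m) :
    IsProfileBranch m (Q m) (Ioo (-1) (1 / m)) := by
  have hm0 : 0 < m := by linarith
  have him : 1 / m < 1 := (div_lt_one hm0).2 hm
  have him0 : 0 < 1 / m := by positivity
  have hsub : Ioo (-1 : ℝ) (1 / m) ⊆ Ioo (-1) 1 := Ioo_subset_Ioo_right him.le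
  have hne : ∀ x ∈ Ioo (-1 : ℝ) (1 / m), 1 - m * x ≠ 0 := fun x hx => by
    have := (lt_div_iff₀ hm0).1 hx.2
    linarith
  have h0 : ∀ x ∈ Ioo (-1 : ℝ) (1 / m), profileField m x ≠ 0 := fun x hx =>
    profileField_ne_zero (hsub hx) (hne x hx)
  have hd : ∀ x ∈ Ioo (-1 : ℝ) (1 / m), HasStrictDerivAt (Q m) (profileField m x)⁻¹ x :=
    fun x hx => hasStrictDerivAt_Q hm (hsub hx) (hne x hx)
  have hlt : -1 < 1 / m := by linarith
  refine ⟨isOpen_Ioo, hsub, h0, hd, bijOn_univ_of_surjOn ordConnected_Ioo hd h0 ?_⟩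
  refine ContinuousOn.surjOn_of_tendsto (nonempty_Ioo.2 hlt)
    (fun x hx => (hd x hx).hasDerivAt.continuousAt.continuousWithinAt) ?_ ?_
  · exact (tendsto_comp_coe_Ioo_atBot hlt).2 (tendsto_Q_neg_one hm)
  · exact (tendsto_comp_coe_Ioo_atTop hlt).2 ((tendsto_Q_inv hm).mono_left (nhdsLT_le_nhdsNE _))

theorem isProfileBranch_Q_upper {m : ℝ} (hm : 1 < m) :
    IsProfileBranch m (Q m) (Ioo (1 / m) 1) := by
  have hm0 : 0 < m := by linarith
  have him : 1 / m < 1 := (div_lt_one hm0).2 hm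
  have him0 : 0 < 1 / m := by positivity
  have hsub : Ioo (1 / m) (1 : ℝ) ⊆ Ioo (-1) 1 := Ioo_subset_Ioo_left (by linarith)
  have hne : ∀ x ∈ Ioo (1 / m) (1 : ℝ), 1 - m * x ≠ 0 := fun x hx => by
    have := (div_lt_iff₀ hm0).1 hx.1
    linarith
  have h0 : ∀ x ∈ Ioo (1 / m) (1 : ℝ), profileField m x ≠ 0 := fun x hx =>
    profileField_ne_zero (hsub hx) (hne x hx)
  have hd : ∀ x ∈ Ioo (1 / m) (1 : ℝ), HasStrictDerivAt (Q m) (profileField m x)⁻¹ x :=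
    fun x hx => hasStrictDerivAt_Q hm (hsub hx) (hne x hx)
  refine ⟨isOpen_Ioo, hsub, h0, hd, bijOn_univ_of_surjOn ordConnected_Ioo hd h0 ?_⟩
  -- The profile field is negative on this branch, so `Q` decreases from `+∞` to `-∞`; hence the
  -- version with reversed limits.
  refine ContinuousOn.surjOn_of_tendsto' (nonempty_Ioo.2 him)
    (fun x hx => (hd x hx).hasDerivAt.continuousAt.continuousWithinAt) ?_ ?_
  · exact (tendsto_comp_coe_Ioo_atBot him).2 ((tendsto_Q_inv hm).mono_left (nhdsGT_le_nhdsNE _))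
  · exact (tendsto_comp_coe_Ioo_atTop him).2 (tendsto_Q_one hm)

/-- `f` is a global solution of the profile equation `f'' = (1 - f'²) (1 - m f')`, with
derivative `w` of absolute value less than one. -/
structure IsProfileSolution (m : ℝ) (f w : ℝ → ℝ) : Prop where
  hasDerivAt : ∀ s, HasDerivAt f (w s) s
  hasDerivAt_deriv : ∀ s, HasDerivAt w (profileField m (w s)) s
  sq_lt_one : ∀ s, w s ^ 2 < 1

theorem IsProfileSolution.contDiff {m : ℝ} {f w : ℝ → ℝ} (h : IsProfileSolution m f w) :
    ContDiff ℝ 2 f := by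
  have hw : Continuous w := continuous_iff_continuousAt.2 fun s =>
    (h.hasDerivAt_deriv s).continuousAt
  have e1 : deriv f = w := funext fun s => (h.hasDerivAt s).deriv
  have e2 : deriv w = fun s => profileField m (w s) := funext fun s =>
    (h.hasDerivAt_deriv s).deriv
  have h1 : ContDiff ℝ 1 w := by
    rw [contDiff_one_iff_deriv, e2]
    refine ⟨fun s => (h.hasDerivAt_deriv s).differentiableAt, ?_⟩
    unfold profileField
    fun_prop
  rw [show (2 : WithTop ℕ∞) = 1 + 1 by norm_num, contDiff_succ_iff_deriv, e1]
  exact ⟨fun s => (h.hasDerivAt s).differentiableAt, by simp, h1⟩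

theorem IsProfileBranch.isProfileSolution {m : ℝ} {h w : ℝ → ℝ} {J : Set ℝ}
    (hb : IsProfileBranch m h J) (hw : IsInverseOn h J w) {f : ℝ → ℝ} {s₀ f₀ : ℝ}
    (hf : ∀ s, f s = (∫ r in s₀..s, w (r - s₀)) + f₀) :
    IsProfileSolution m f (fun s => w (s - s₀)) := by
  have hd : ∀ s, HasDerivAt w (profileField m (w s)) s :=
    hw.hasDerivAt hb.isOpen hb.deriv hb.ne_zero
  have hd' : ∀ s, HasDerivAt (fun s => w (s - s₀)) (profileField m (w (s - s₀))) s := fun s => by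
    exact (hd (s - s₀)).comp_sub_const s s₀
  have hc : Continuous fun s => w (s - s₀) :=
    continuous_iff_continuousAt.2 fun s => (hd' s).continuousAt
  refine ⟨fun s => ?_, hd', fun s => ?_⟩
  · rw [show f = fun s => (∫ r in s₀..s, w (r - s₀)) + f₀ from funext hf]
    exact (intervalIntegral.integral_hasDerivAt_right (hc.intervalIntegrable _ _)
      (hc.stronglyMeasurableAtFilter _ _) hc.continuousAt).add_const f₀
  · have := hb.subset (hw.1 (mem_univ (s - s₀)))
    rw [sq_lt_one_iff_abs_lt_one, abs_lt]
    exact this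

theorem IsProfile.exists_isProfileSolution {n : ℕ} {f : ℝ → ℝ} (hf : IsProfile n f) :
    ∃ w, IsProfileSolution ((n : ℝ) - 1) f w := by
  have hm : 2 < n → 1 < (n : ℝ) - 1 := fun h => by
    have : (2 : ℝ) < n := by exact_mod_cast h
    linarith
  rcases hf with ⟨hn, f₀, hf⟩ | ⟨hn, w, hw, s₀, f₀, hf⟩ | ⟨hn, w, hw, s₀, f₀, hf⟩ |
    ⟨hn, w, hw, s₀, f₀, hf⟩
  · have h1 := hm hn
    refine ⟨fun _ => 1 / ((n : ℝ) - 1), fun s => ?_, fun s => ?_, fun s => ?_⟩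
    · rw [show f = fun s => s / ((n : ℝ) - 1) + f₀ from funext hf]
      exact ((hasDerivAt_id s).div_const _).add_const f₀
    · have : profileField ((n : ℝ) - 1) (1 / ((n : ℝ) - 1)) = 0 := by
        have : (n : ℝ) - 1 ≠ 0 := by linarith
        simp [profileField, this]
      rw [this]
      exact hasDerivAt_const _ _
    · have h0 : 0 < 1 / ((n : ℝ) - 1) := one_div_pos.2 (by linarith)
      have h2 : 1 / ((n : ℝ) - 1) < 1 := (div_lt_one (by linarith)).2 h1
      exact pow_lt_one₀ h0.le h2 two_ne_zero
  · have h1 : (n : ℝ) - 1 = 1 := by rw [hn]; norm_num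
    rw [h1]
    exact ⟨_, isProfileBranch_P.isProfileSolution hw hf⟩
  · exact ⟨_, (isProfileBranch_Q_lower (hm hn)).isProfileSolution hw hf⟩
  · exact ⟨_, (isProfileBranch_Q_upper (hm hn)).isProfileSolution hw hf⟩

/-! ### Classification of the solutions on an interval -/

theorem exists_add_const_of_hasDerivAt {f g w : ℝ → ℝ} {I : Set ℝ} (hIo : IsOpen I)
    (hI : I.OrdConnected) (hne : I.Nonempty) (hf : ∀ s ∈ I, HasDerivAt f (w s) s)
    (hg : ∀ s ∈ I, HasDerivAt g (w s) s) : ∃ a, ∀ s ∈ I, g s = f s + a := by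
  obtain ⟨s₀, hs₀⟩ := hne
  refine ⟨g s₀ - f s₀, fun s hs => ?_⟩
  have hd : ∀ t ∈ I, HasDerivAt (fun t => g t - f t) 0 t := fun t ht => by
    simpa using (hg t ht).fun_sub (hf t ht)
  have := hIo.is_const_of_deriv_eq_zero hI.isPreconnected
    (fun t ht => (hd t ht).differentiableAt.differentiableWithinAt)
    (fun t ht => (hd t ht).deriv) hs hs₀
  linarith

/-- A solution of the profile equation with values in a branch is given by the inverse of the
antiderivative. -/
theorem IsProfileBranch.exists_primitive {m : ℝ} {h g w : ℝ → ℝ} {I J : Set ℝ}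
    (hb : IsProfileBranch m h J) (hIo : IsOpen I) (hI : I.OrdConnected) (hne : I.Nonempty)
    (hg : ∀ s ∈ I, HasDerivAt g (w s) s)
    (hw : ∀ s ∈ I, HasDerivAt w (profileField m (w s)) s) (hwJ : ∀ s ∈ I, w s ∈ J) :
    ∃ f, IsPrimitiveOfInverse h J f ∧ ∀ s ∈ I, g s = f s := by
  obtain ⟨W, hW⟩ := exists_isInverseOn hb.bijOn
  -- Separation of variables; the integration constant `a` found next gives the shift `s₀ = -a`.
  have hd : ∀ s ∈ I, HasDerivAt (fun s => h (w s)) 1 s := fun s hs => by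
    have := (hb.deriv _ (hwJ s hs)).hasDerivAt.comp s (hw s hs)
    rwa [inv_mul_cancel₀ (hb.ne_zero _ (hwJ s hs))] at this
  obtain ⟨a, ha⟩ := exists_add_const_of_hasDerivAt hIo hI hne
    (fun s _ => hasDerivAt_id s) hd
  have hwW : ∀ s ∈ I, w s = W (s - -a) := fun s hs => by
    rw [sub_neg_eq_add, ← id_def (α := ℝ) (a := s), ← ha s hs]
    exact (hW.2.1 (hwJ s hs)).symm
  have hsol := hb.isProfileSolution hW (f := fun s => (∫ r in (-a)..s, W (r - -a)) + 0)
    (fun _ => rfl)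
  obtain ⟨b, hb'⟩ := exists_add_const_of_hasDerivAt hIo hI hne
    (fun s _ => hsol.hasDerivAt s) (fun s hs => hwW s hs ▸ hg s hs)
  refine ⟨fun s => (∫ r in (-a)..s, W (r - -a)) + b, ⟨W, hW, -a, b, fun _ => rfl⟩, fun s hs => ?_⟩
  simpa using hb' s hs

/-- A solution of the profile equation that takes the stationary value is constant. -/
theorem eq_of_profileField_eq_zero {m a : ℝ} {w : ℝ → ℝ} {I : Set ℝ} (hIo : IsOpen I)
    (hI : I.OrdConnected) (hw : ∀ s ∈ I, HasDerivAt w (profileField m (w s)) s)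
    (hw1 : ∀ s ∈ I, w s ∈ Ioo (-1 : ℝ) 1) (ha : a ∈ Ioo (-1 : ℝ) 1)
    (ha0 : profileField m a = 0) {s₀ : ℝ} (hs₀ : s₀ ∈ I) (h₀ : w s₀ = a) :
    ∀ s ∈ I, w s = a := by
  -- The cubic field is not globally Lipschitz, but the solutions stay in this compact interval.
  have hL : ∃ K, LipschitzOnWith K (profileField m) (Icc (-1) 1) := by
    have hc : ContDiff ℝ 1 (profileField m) := by unfold profileField; fun_prop
    exact hc.locallyLipschitz.locallyLipschitzOn.exists_lipschitzOnWith_of_compact isCompact_Icc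
  obtain ⟨K, hK⟩ := hL
  intro s hs
  have hsub : uIcc s₀ s ⊆ I := hI.uIcc_subset hs₀ hs
  -- The uniqueness theorem works on an open interval, so the segment from `s₀` to `s` is enlarged
  -- slightly inside the open set `I`.
  obtain ⟨c, d, hcd, hIcd⟩ : ∃ c d, s₀ ∈ Ioo c d ∧ s ∈ Ioo c d ∧ Ioo c d ⊆ I := by
    obtain ⟨c, hc, hcI⟩ := exists_Ioc_subset_of_mem_nhds
      (hIo.mem_nhds (hsub (show min s₀ s ∈ uIcc s₀ s from ⟨le_rfl, min_le_max⟩))) (exists_lt _)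
    obtain ⟨d, hd, hdI⟩ := exists_Ico_subset_of_mem_nhds
      (hIo.mem_nhds (hsub (show max s₀ s ∈ uIcc s₀ s from ⟨min_le_max, le_rfl⟩))) (exists_gt _)
    refine ⟨c, d, ⟨hc.trans_le (min_le_left _ _), (le_max_left _ _).trans_lt hd⟩,
      ⟨hc.trans_le (min_le_right _ _), (le_max_right _ _).trans_lt hd⟩, fun t ht => ?_⟩
    rcases le_or_gt t (min s₀ s) with h | h
    · exact hcI ⟨ht.1, h⟩
    · rcases le_or_gt (max s₀ s) t with h' | h'
      · exact hdI ⟨h', ht.2⟩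
      · exact hsub ⟨h.le, h'.le⟩
  refine ODE_solution_unique_of_mem_Ioo (v := fun _ => profileField m)
    (s := fun _ => Icc (-1) 1) (g := fun _ => a) (fun _ _ => hK) hcd
    (fun t ht => ⟨hw t (hIcd.2 ht), Ioo_subset_Icc_self (hw1 t (hIcd.2 ht))⟩)
    (fun t _ => ⟨?_, Ioo_subset_Icc_self ha⟩) h₀ hIcd.1
  simpa [ha0] using hasDerivAt_const t a

theorem exists_isProfile {n : ℕ} (hn : 2 ≤ n) {g w : ℝ → ℝ} {I : Set ℝ} (hIo : IsOpen I)
    (hI : I.OrdConnected) (hne : I.Nonempty) (hg : ∀ s ∈ I, HasDerivAt g (w s) s)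
    (hw : ∀ s ∈ I, HasDerivAt w (profileField ((n : ℝ) - 1) (w s)) s)
    (hw1 : ∀ s ∈ I, w s ^ 2 < 1) : ∃ f, IsProfile n f ∧ ∀ s ∈ I, g s = f s := by
  have hw1' : ∀ s ∈ I, w s ∈ Ioo (-1 : ℝ) 1 := fun s hs =>
    abs_lt.1 ((sq_lt_one_iff_abs_lt_one _).1 (hw1 s hs))
  rcases hn.eq_or_lt with rfl | hn
  · have h1 : ((2 : ℕ) : ℝ) - 1 = 1 := by norm_num
    rw [h1] at hw
    obtain ⟨f, hf, hgf⟩ := isProfileBranch_P.exists_primitive hIo hI hne hg hw hw1'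
    exact ⟨f, Or.inr (Or.inl ⟨rfl, hf⟩), hgf⟩
  have hm : 1 < (n : ℝ) - 1 := by
    have : (2 : ℝ) < n := by exact_mod_cast hn
    linarith
  have hm0 : 0 < (n : ℝ) - 1 := by linarith
  have hmem : 1 / ((n : ℝ) - 1) ∈ Ioo (-1 : ℝ) 1 :=
    ⟨by linarith [one_div_pos.2 hm0], (div_lt_one hm0).2 hm⟩
  by_cases hex : ∃ s ∈ I, w s = 1 / ((n : ℝ) - 1)
  · obtain ⟨s₀, hs₀, h₀⟩ := hex
    have hconst := eq_of_profileField_eq_zero hIo hI hw hw1' hmem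
      (by simp [profileField, hm0.ne']) hs₀ h₀
    obtain ⟨a, ha⟩ := exists_add_const_of_hasDerivAt hIo hI hne
      (fun s _ => (hasDerivAt_id s).div_const ((n : ℝ) - 1)) (fun s hs => hconst s hs ▸ hg s hs)
    exact ⟨fun s => s / ((n : ℝ) - 1) + a, Or.inl ⟨hn, a, fun _ => rfl⟩, ha⟩
  push Not at hex
  have hpre : (w '' I).OrdConnected := (hI.isPreconnected.image w fun s hs =>
    (hw s hs).continuousAt.continuousWithinAt).ordConnected
  have hside : (∀ s ∈ I, w s < 1 / ((n : ℝ) - 1)) ∨ ∀ s ∈ I, 1 / ((n : ℝ) - 1) < w s := by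
    by_contra! H
    obtain ⟨⟨s, hs, h1⟩, t, ht, h2⟩ := H
    obtain ⟨r, hr, hr'⟩ := hpre.out (mem_image_of_mem w ht) (mem_image_of_mem w hs) ⟨h2, h1⟩
    exact hex r hr hr'
  rcases hside with h | h
  · obtain ⟨f, hf, hgf⟩ := (isProfileBranch_Q_lower hm).exists_primitive hIo hI hne hg hw
      fun s hs => ⟨(hw1' s hs).1, h s hs⟩
    exact ⟨f, Or.inr (Or.inr (Or.inl ⟨hn, hf⟩)), hgf⟩
  · obtain ⟨f, hf, hgf⟩ := (isProfileBranch_Q_upper hm).exists_primitive hIo hI hne hg hw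
      fun s hs => ⟨h s hs, (hw1' s hs).2⟩
    exact ⟨f, Or.inr (Or.inr (Or.inr ⟨hn, hf⟩)), hgf⟩

end HESU

end

noncomputable section

namespace HESU

open Filter Topology

variable {n : ℕ}

theorem pd_congr_of_eventuallyEq {i : Fin n} {u v : (Fin n → ℝ) → ℝ} {x : Fin n → ℝ}
    (h : u =ᶠ[𝓝 x] v) : pd i u x = pd i v x := by
  rw [pd, pd, h.fderiv_eq]

variable [NeZero n]

/-! ### Functions of the form `f ∘ ρ` -/

theorem hasFDerivAt_rho {x : Fin n → ℝ} (hx : x 0 ≠ 0) :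
    HasFDerivAt (rho (n := n))
      ((-(x 0)⁻¹) • ContinuousLinearMap.proj (R := ℝ) (φ := fun _ : Fin n => ℝ) 0) x := by
  have h1 : HasFDerivAt (fun z : Fin n → ℝ => z 0)
      (ContinuousLinearMap.proj (R := ℝ) (φ := fun _ : Fin n => ℝ) 0) x := hasFDerivAt_apply _ x
  have h2 := (Real.hasDerivAt_log hx).neg.comp_hasFDerivAt x h1
  exact h2

/-- Chain rule with `dρ = -dx₁/x₁`. Differentiability is asked only at values of `ρ` on `Ω`, since
the profile of a given `u` is controlled only there. -/
theorem radialJet_of_eqOn {Ω : Set (Fin n → ℝ)} (hΩ : Ω ⊆ halfSpace n) (hΩo : IsOpen Ω)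
    {u : (Fin n → ℝ) → ℝ} {f w : ℝ → ℝ} (hu : ∀ z ∈ Ω, u z = f (rho z))
    (hf : ∀ z ∈ Ω, HasDerivAt f (w (rho z)) (rho z)) {x : Fin n → ℝ} (hx : x ∈ Ω) {q : ℝ}
    (hw : HasDerivAt w q (rho x)) : RadialJet u x (w (rho x)) q := by
  have h1 : ∀ z ∈ Ω, ∀ i, pd i u z = if i = 0 then -w (rho z) / z 0 else 0 := by
    intro z hz i
    have hz0 : 0 < z 0 := hΩ hz
    rw [pd_congr_of_eventuallyEq (v := f ∘ rho)
      (by filter_upwards [hΩo.mem_nhds hz] with y hy using hu y hy), pd,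
      ((hf z hz).comp_hasFDerivAt z (hasFDerivAt_rho hz0.ne')).fderiv]
    by_cases hi : i = 0
    · subst hi
      simp
      ring
    · simp [hi, Ne.symm hi]
  refine ⟨h1 x hx, fun i => ?_⟩
  have hx0 : 0 < x 0 := hΩ hx
  rw [pd_congr_of_eventuallyEq (v := fun z => if i = 0 then -w (rho z) / z 0 else 0)
      (by filter_upwards [hΩo.mem_nhds hx] with y hy using h1 y hy i)]
  by_cases hi : i = 0
  · subst hi
    simp only [if_true]
    have hc : HasFDerivAt (fun z : Fin n → ℝ => z 0)
        (ContinuousLinearMap.proj (R := ℝ) (φ := fun _ : Fin n => ℝ) 0) x := hasFDerivAt_apply _ x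
    have hinv := (hasDerivAt_inv hx0.ne').comp_hasFDerivAt x hc
    have hwr := (hw.comp_hasFDerivAt x (hasFDerivAt_rho hx0.ne')).neg
    have := hwr.mul hinv
    have e : (fun z : Fin n → ℝ => -w (rho z) / z 0) =
        (-(w ∘ rho)) * ((fun t : ℝ => t⁻¹) ∘ fun z : Fin n → ℝ => z 0) := by
      ext z; simp [div_eq_mul_inv]
    rw [pd, e]
    erw [this.fderiv]
    simp
    field_simp
    ring
  · simp [hi, pd_const]

/-! ### Graphs foliated by horospheres -/

theorem foliatedByHorospheres_iff {Ω : Set (Fin n → ℝ)} (hΩ : Ω ⊆ halfSpace n)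
    {u : (Fin n → ℝ) → ℝ} :
    FoliatedByHorospheres Ω u ↔ ∀ x ∈ Ω, ∀ y, y 0 = x 0 → y ∈ Ω ∧ u y = u x := by
  constructor
  · intro h x hx y hy
    obtain ⟨c, -, t, ⟨hc, ht⟩, hsub⟩ := h (x, u x) ⟨x, hx, rfl⟩
    have hc' : x 0 = c := hc
    have ht' : u x = t := ht
    obtain ⟨z, hz, hzy⟩ := hsub (show (y, t) ∈ horosphere n c ×ˢ {t} from ⟨hy.trans hc', rfl⟩)
    obtain ⟨rfl, h2⟩ := Prod.mk.inj hzy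
    exact ⟨hz, h2.trans ht'.symm⟩
  · rintro h _ ⟨x, hx, rfl⟩
    refine ⟨x 0, hΩ hx, u x, ⟨rfl, rfl⟩, ?_⟩
    rintro ⟨y, t⟩ ⟨hy, ht⟩
    obtain ⟨h1, h2⟩ := h x hx y hy
    exact ⟨y, h1, Prod.ext rfl (h2.trans (mem_singleton_iff.1 ht).symm)⟩

theorem HasListedProfile.foliatedByHorospheres {Ω : Set (Fin n → ℝ)} {u : (Fin n → ℝ) → ℝ}
    (hΩ : Ω ⊆ halfSpace n) (h : HasListedProfile Ω u) : FoliatedByHorospheres Ω u := by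
  rw [foliatedByHorospheres_iff hΩ]
  obtain ⟨I, -, -, hΩI, f, -, -, hu⟩ := h
  intro x hx y hy
  have hr : rho y = rho x := by simp [rho, hy]
  have hyΩ : y ∈ Ω := by
    rw [hΩI] at hx ⊢
    exact ⟨(show 0 < y 0 from hy ▸ hx.1), hr ▸ hx.2⟩
  exact ⟨hyΩ, by rw [hu y hyΩ, hu x hx, hr]⟩

theorem HasListedProfile.isSpacelike_and_isTranslator {Ω : Set (Fin n → ℝ)}
    {u : (Fin n → ℝ) → ℝ} (hΩ : Ω ⊆ halfSpace n) (hΩo : IsOpen Ω)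
    (h : HasListedProfile Ω u) : IsSpacelike Ω u ∧ IsTranslator Ω u := by
  obtain ⟨I, -, -, -, f, -, hf, hu⟩ := h
  obtain ⟨w, hw⟩ := hf.exists_isProfileSolution
  have hjet : ∀ x ∈ Ω, RadialJet u x (w (rho x)) (profileField ((n : ℝ) - 1) (w (rho x))) :=
    fun x hx => radialJet_of_eqOn hΩ hΩo hu (fun z _ => hw.hasDerivAt (rho z)) hx
      (hw.hasDerivAt_deriv (rho x))
  exact ⟨fun x hx => ((hjet x hx).posDef_iff (hΩ hx)).2 (hw.sq_lt_one _),
    fun x hx => ((hjet x hx).translator_iff (hΩ hx) (hw.sq_lt_one _)).2 rfl⟩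

theorem FoliatedByHorospheres.hasListedProfile (hn : 2 ≤ n) {Ω : Set (Fin n → ℝ)}
    {u : (Fin n → ℝ) → ℝ} (hΩ : Ω ⊆ halfSpace n) (hΩo : IsOpen Ω) (hΩc : IsConnected Ω)
    (hu : ContDiffOn ℝ 2 u Ω) (hs : IsSpacelike Ω u) (ht : IsTranslator Ω u)
    (h : FoliatedByHorospheres Ω u) : HasListedProfile Ω u := by
  rw [foliatedByHorospheres_iff hΩ] at h
  -- A vertical geodesic that meets each horosphere once, parametrised so that `ρ (γ s) = s`; the
  -- profile of `u` is its restriction to this curve.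
  set γ : ℝ → Fin n → ℝ := fun s => Pi.single 0 (Real.exp (-s)) with hγ
  have hγ0 : ∀ s, γ s 0 = Real.exp (-s) := fun s => by simp [hγ]
  have hγr : ∀ s, rho (γ s) = s := fun s => by simp [rho, hγ0]
  have hγx : ∀ x ∈ halfSpace n, γ (rho x) 0 = x 0 := fun x hx => by
    rw [hγ0, rho, neg_neg, Real.exp_log hx]
  have hγc : ContDiff ℝ 2 γ := by
    rw [contDiff_pi]
    intro i
    by_cases hi : i = 0
    · subst hi
      simp only [hγ0]
      fun_prop
    · have : (fun s => γ s i) = fun _ => 0 := by ext s; simp [hγ, hi]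
      rw [this]
      exact contDiff_const
  set I : Set ℝ := γ ⁻¹' Ω with hI
  have hmem : ∀ x ∈ halfSpace n, rho x ∈ I ↔ x ∈ Ω := fun x hx =>
    ⟨fun H => (h _ H x (hγx x hx).symm).1, fun H => (h x H _ (hγx x hx)).1⟩
  have hIimg : I = rho '' Ω := by
    ext s
    constructor
    · intro H
      exact ⟨γ s, H, hγr s⟩
    · rintro ⟨x, hx, rfl⟩
      exact (hmem x (hΩ hx)).2 hx
  have hIo : IsOpen I := hΩo.preimage hγc.continuous
  have hIc : I.OrdConnected := by
    rw [hIimg]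
    exact (hΩc.isPreconnected.image _ fun x hx =>
      (hasFDerivAt_rho (hΩ hx).ne').continuousAt.continuousWithinAt).ordConnected
  have hIne : I.Nonempty := by
    rw [hIimg]
    exact hΩc.nonempty.image _
  set g : ℝ → ℝ := u ∘ γ with hg
  have hgc : ContDiffOn ℝ 2 g I := hu.comp hγc.contDiffOn fun s hs => hs
  have hug : ∀ x ∈ Ω, u x = g (rho x) := fun x hx => (h x hx _ (hγx x (hΩ hx))).2.symm
  have hg1 : ∀ s ∈ I, HasDerivAt g (deriv g s) s := fun s hs =>
    ((hgc.contDiffAt (hIo.mem_nhds hs)).differentiableAt (by norm_num)).hasDerivAt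
  have hgd : ContDiffOn ℝ 1 (deriv g) I :=
    ((contDiffOn_succ_iff_deriv_of_isOpen (n := 1) hIo).1 (by norm_num; exact hgc)).2.2
  have hg2 : ∀ s ∈ I, HasDerivAt (deriv g) (deriv (deriv g) s) s := fun s hs =>
    ((hgd.contDiffAt (hIo.mem_nhds hs)).differentiableAt (by norm_num)).hasDerivAt
  have hjet : ∀ s ∈ I, RadialJet u (γ s) (deriv g s) (deriv (deriv g) s) := fun s hs => by
    have := radialJet_of_eqOn (x := γ s) (w := deriv g) (q := deriv (deriv g) s) hΩ hΩo hug
      (fun z hz => hg1 _ ((hmem z (hΩ hz)).2 hz)) hs (by rw [hγr]; exact hg2 s hs)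
    rwa [hγr] at this
  have hsq : ∀ s ∈ I, deriv g s ^ 2 < 1 := fun s hs' =>
    ((hjet s hs').posDef_iff (hΩ hs')).1 (hs _ hs')
  obtain ⟨f, hf, hgf⟩ := exists_isProfile hn hIo hIc hIne hg1 (fun s hs' => by
    have := ((hjet s hs').translator_iff (hΩ hs') (hsq s hs')).1 (ht _ hs')
    rw [profileField, ← this]
    exact hg2 s hs') hsq
  -- `g` is only known to be `C²` on `I`; the listed `f` is `C²` on the whole line because it solves
  -- the equation globally.
  obtain ⟨w, hw⟩ := hf.exists_isProfileSolution
  refine ⟨I, hIo, hIc, ?_, f, hw.contDiff, hf, fun x hx => ?_⟩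
  · ext x
    exact ⟨fun hx => ⟨hΩ hx, (hmem x (hΩ hx)).2 hx⟩, fun hx => (hmem x hx.1).1 hx.2⟩
  · rw [hug x hx, hgf _ ((hmem x (hΩ hx)).2 hx)]

end HESU

end

theorem theorem3p1 (n : ℕ) [NeZero n] (hn : 2 ≤ n) (Ω : Set (Fin n → ℝ))
    (hΩ : Ω ⊆ HESU.halfSpace n) (hΩo : IsOpen Ω) (hΩc : IsConnected Ω)
    (u : (Fin n → ℝ) → ℝ) (hu : ContDiffOn ℝ 2 u Ω) :
    (HESU.IsSpacelike Ω u → HESU.IsTranslator Ω u →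
      (HESU.FoliatedByHorospheres Ω u ↔ HESU.HasListedProfile Ω u)) ∧
    (HESU.HasListedProfile Ω u → HESU.IsSpacelike Ω u ∧ HESU.IsTranslator Ω u) :=
  ⟨fun hs ht => ⟨fun h => h.hasListedProfile hn hΩ hΩo hΩc hu hs ht,
    fun h => h.foliatedByHorospheres hΩ⟩, fun h => h.isSpacelike_and_isTranslator hΩ hΩo⟩
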